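/- For a finite group $G$ let $\operatorname{Irr}(G)$ denote the set of irreducible complex characters of $G$; for $\chi\in\operatorname{Irr}(G)$ let $\overline{\chi}$ be its complex conjugate, and let $\eta(\chi,\overline{\chi})$ be the number of distinct irreducible constituents of the product character $\chi\overline{\chi}$. **Proposition.** Let $p$ be a prime number and let $n\ge 0$ be an integer. Then there exist a finite $p$-group $G$ and a character $\chi\in\operatorname{Irr}(G)$ such that $\chi\neq\overline{\chi}$, $\eta(\chi,\overline{\chi})=2n(p-1)+1$ and $\chi(1)=p^n$. -/

import Mathlib

noncomputable section

namespace CharTheory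

/-- `Irr G`: the set of irreducible complex characters of `G`, as functions `G → ℂ`: the characters
of the irreducible finite-dimensional complex representations of `G`. -/
def Irr (G : Type*) [Group G] : Set (G → ℂ) :=
  {χ | ∃ (V : Type) (_ : AddCommGroup V) (_ : Module ℂ V) (_ : FiniteDimensional ℂ V)
      (ρ : Representation ℂ G V), ρ.IsIrreducible ∧ ρ.character = χ}

/-- The complex conjugate of a complex-valued function: `conj χ g` is the conjugate of `χ g`. -/
def conj {G : Type*} (χ : G → ℂ) : G → ℂ := fun g => starRingEnd ℂ (χ g)

/-- The inner product of class functions, `[φ, θ] = |G|⁻¹ ∑ g, φ(g) * conj (θ(g))`. -/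
def charInner {G : Type*} [Fintype G] (φ θ : G → ℂ) : ℂ :=
  (Fintype.card G : ℂ)⁻¹ * ∑ g : G, φ g * conj θ g

open scoped ComplexOrder in
/-- The set of irreducible constituents of a character `Θ`: those `ψ ∈ Irr G` with `[ψ, Θ] > 0`.
The order on `ℂ` is the usual one, so `0 < z` says that `z` is a positive real number. -/
def constituents {G : Type*} [Group G] [Fintype G] (Θ : G → ℂ) : Set (G → ℂ) :=
  {ψ | ψ ∈ Irr G ∧ 0 < charInner ψ Θ}

/-- `η(χ, ψ)`: the number of distinct irreducible constituents of the product `χψ`. -/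
def eta {G : Type*} [Group G] [Fintype G] (χ ψ : G → ℂ) : ℕ :=
  (constituents (χ * ψ)).ncard

end CharTheory

end

/-!
The group is `G = (R → A) ⋊ (R ⋊ U)` with `R = ZMod (p ^ n)`, `A = ZMod (p ^ 2)` and `U` the group of
units of `R` congruent to `1` modulo `p`: functions on `R`, extended by the affine maps
`x ↦ u * x + b`. It acts monomially on a space with basis `e x`, `x ∈ R`, a function `f` multiplying
`e x` by `ψ (f x)` for a faithful character `ψ` of `A`. The character `χ` of this representation has
degree `p ^ n`, and it is not real because `p ^ 2 > 2`.

The product of `χ` with its conjugate is the character of the span of the vectors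
`e x ⊗ conj (e y)`. Those with `x ≠ y` are permuted by `G` up to scalars. The diagonal ones give the
permutation representation of the affine group on the functions on `R`, and there the Fourier basis is
permuted up to scalars (`AffineWreath.card_fixed_eq_char_fourierRep`). So `χ * conj χ` is again a
monomial character (`AffineWreath.char_pointRep_mul_conj`). Any two of its basis vectors are
distinguished by an element of `G` fixing both lines
(`AffineWreath.offDiag_sum_fourierRep_separated`), and by Mackey's criterion the irreducible
constituents then correspond to the orbits of lines (`Monomial.Separated.ncard_constituents`).

These are the `U`-orbits of nonzero differences `x - y` together with the `U`-orbits of frequencies.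
A nonzero element of `R` is determined up to `U` by its valuation, one of `n` values, and its leading
`p`-adic digit, one of `p - 1` values (`ZMod.card_orbits_principalUnits`). So there are `n * (p - 1)`
orbits of the first kind and `n * (p - 1) + 1` of the second.
-/

open Finset CharTheory

/-! ### Monomial representations -/

/-- A monomial representation of `G` with unitary coefficients, given by its effect on a basis
indexed by `ι`: the element `g` sends the basis vector `e i` to `coeff g i • e (act g i)`. -/
structure Monomial (G ι : Type*) [Group G] where
  /-- The permutation action on the lines spanned by the basis vectors. -/
  act : G → ι → ι
  /-- The scalars by which the basis vectors are multiplied. -/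
  coeff : G → ι → ℂ
  act_one : ∀ i, act 1 i = i
  act_mul : ∀ g h i, act (g * h) i = act g (act h i)
  coeff_mul : ∀ g h i, coeff (g * h) i = coeff g (act h i) * coeff h i
  norm_coeff : ∀ g i, ‖coeff g i‖ = 1

namespace Monomial

variable {G ι κ : Type*} [Group G]

attribute [simp] act_one norm_coeff

section Basic

variable (M : Monomial G ι)

@[simp] lemma act_inv_act (g : G) (i : ι) : M.act g⁻¹ (M.act g i) = i := by
  rw [← M.act_mul, inv_mul_cancel, M.act_one]

@[simp] lemma act_act_inv (g : G) (i : ι) : M.act g (M.act g⁻¹ i) = i := by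
  rw [← M.act_mul, mul_inv_cancel, M.act_one]

lemma act_injective (g : G) : Function.Injective (M.act g) :=
  Function.LeftInverse.injective (M.act_inv_act g)

lemma act_inv_eq_iff {g : G} {i j : ι} : M.act g⁻¹ i = j ↔ i = M.act g j := by
  constructor
  · rintro rfl; simp
  · rintro rfl; simp

lemma coeff_ne_zero (g : G) (i : ι) : M.coeff g i ≠ 0 := by
  rw [← norm_ne_zero_iff, M.norm_coeff]; exact one_ne_zero

@[simp] lemma coeff_one (i : ι) : M.coeff 1 i = 1 := by
  have h := M.coeff_mul 1 1 i
  rw [mul_one, M.act_one] at h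
  exact (mul_eq_left₀ (M.coeff_ne_zero 1 i)).mp h.symm

@[simp] lemma conj_coeff_mul_coeff (g : G) (i : ι) :
    starRingEnd ℂ (M.coeff g i) * M.coeff g i = 1 := by
  rw [Complex.conj_mul', M.norm_coeff]; simp

lemma conj_coeff (g : G) (i : ι) : starRingEnd ℂ (M.coeff g i) = (M.coeff g i)⁻¹ :=
  eq_inv_of_mul_eq_one_left (M.conj_coeff_mul_coeff g i)

/-- The representation on `ι → ℂ` described by monomial data. -/
def rep : Representation ℂ G (ι → ℂ) where
  toFun g :=
    { toFun := fun v j => M.coeff g (M.act g⁻¹ j) * v (M.act g⁻¹ j)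
      map_add' := fun v w => by ext j; simp [mul_add]
      map_smul' := fun c v => by ext j; simp; ring }
  map_one' := by ext; simp
  map_mul' g h := by
    ext i j
    simp [M.act_mul, M.coeff_mul, mul_assoc]

lemma rep_apply (g : G) (v : ι → ℂ) (j : ι) :
    M.rep g v j = M.coeff g (M.act g⁻¹ j) * v (M.act g⁻¹ j) := rfl

lemma rep_single [DecidableEq ι] (g : G) (i : ι) :
    M.rep g (Pi.single i 1) = M.coeff g i • Pi.single (M.act g i) 1 := by
  ext j
  simp only [rep_apply, Pi.smul_apply, smul_eq_mul, Pi.single_apply, M.act_inv_eq_iff]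
  split_ifs with h
  · simp [h]
  · simp

open scoped Classical in
/-- The character of a monomial representation: only the fixed lines contribute to the trace. -/
noncomputable def char [Fintype ι] (g : G) : ℂ := ∑ i, if M.act g i = i then M.coeff g i else 0

lemma character_rep [Fintype ι] : M.rep.character = M.char := by
  classical
  ext g
  rw [Representation.character, LinearMap.trace_eq_matrix_trace ℂ (Pi.basisFun ℂ ι),
    Matrix.trace, char]
  refine sum_congr rfl fun i _ => ?_
  simp [rep_single, Pi.single_apply, eq_comm]

lemma char_one [Fintype ι] : M.char 1 = Fintype.card ι := by simp [char]

lemma conj_char [Fintype ι] (g : G) : starRingEnd ℂ (M.char g) = M.char g⁻¹ := by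
  rw [char, char, map_sum]
  refine sum_congr rfl fun i _ => ?_
  rw [M.act_inv_eq_iff, eq_comm (a := i)]
  split_ifs with h
  · have h1 := M.coeff_mul g⁻¹ g i
    rw [inv_mul_cancel, coeff_one, h] at h1
    rw [conj_coeff, eq_comm]
    exact eq_inv_of_mul_eq_one_left h1.symm
  · simp

/-- Any two basis vectors are told apart by an element of `G` that fixes both of their lines. By
Mackey's criterion this says that the representation is multiplicity-free and that every orbit of
lines spans an irreducible subrepresentation. -/
def Separated : Prop :=
  ∀ i j, i ≠ j → ∃ h, M.act h i = i ∧ M.act h j = j ∧ M.coeff h i ≠ M.coeff h j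

end Basic

section Irreducible

variable [Fintype G] {M : Monomial G ι}

open scoped Classical in
/-- Averaging against the linear character by which the stabilizer of a line acts on it is, up to
a scalar, the projection onto that line: every other coordinate is killed because a separating
element multiplies it by a scalar different from `1`. -/
lemma Separated.sum_stabilizer (hM : M.Separated) (i : ι) (v : ι → ℂ) :
    ∑ g : G, (if M.act g i = i then starRingEnd ℂ (M.coeff g i) else 0) • M.rep g v =
      ((#{g : G | M.act g i = i} : ℂ) * v i) • Pi.single i 1 := by
  ext k
  rw [Finset.sum_apply, Pi.smul_apply, smul_eq_mul, Pi.single_apply]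
  simp only [Pi.smul_apply, smul_eq_mul]
  split_ifs with hk
  · subst hk
    rw [mul_one, card_filter, Nat.cast_sum, sum_mul]
    refine sum_congr rfl fun g _ => ?_
    split_ifs with hg
    · have : M.act g⁻¹ k = k := M.act_inv_eq_iff.mpr hg.symm
      rw [rep_apply, this, ← mul_assoc, conj_coeff_mul_coeff, Nat.cast_one]
    · simp
  · obtain ⟨h, hi, hk', hne⟩ := hM i k (Ne.symm hk)
    rw [mul_zero]
    set S := ∑ g : G, (if M.act g i = i then starRingEnd ℂ (M.coeff g i) else 0) * M.rep g v k
      with hS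
    have key : S = starRingEnd ℂ (M.coeff h i) * M.coeff h k * S := by
      conv_lhs => rw [hS, ← Equiv.sum_comp (Equiv.mulLeft h)]
      rw [hS, mul_sum]
      refine sum_congr rfl fun g _ => ?_
      have h1 : M.act (h * g) i = i ↔ M.act g i = i := by
        rw [M.act_mul]
        constructor
        · intro h2; exact M.act_injective h (h2.trans hi.symm)
        · intro h2; rw [h2, hi]
      have h2 : M.rep (h * g) v k = M.coeff h k * M.rep g v k := by
        rw [map_mul, Module.End.mul_apply, rep_apply _ h, M.act_inv_eq_iff.mpr hk'.symm]
      simp only [Equiv.coe_mulLeft, h1, h2]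
      split_ifs with h3
      · rw [M.coeff_mul, h3, map_mul]; ring
      · simp
    have hc : starRingEnd ℂ (M.coeff h i) * M.coeff h k ≠ 1 := by
      rw [conj_coeff]
      intro h4
      exact hne ((inv_mul_eq_one₀ (M.coeff_ne_zero h i)).mp h4)
    by_contra hS0
    exact hc ((mul_eq_right₀ hS0).mp key.symm)

lemma Separated.isIrreducible [Finite ι] [Nonempty ι] (hM : M.Separated)
    (htrans : ∀ i j, ∃ g, M.act g i = j) : M.rep.IsIrreducible := by
  classical
  have := Fintype.ofFinite ι
  have hbot : ∀ N : Subrepresentation M.rep, N.toSubmodule = ⊥ ∨ N.toSubmodule = ⊤ := by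
    intro N
    refine or_iff_not_imp_left.mpr fun hN => ?_
    obtain ⟨v, hv, hv0⟩ := N.toSubmodule.exists_mem_ne_zero_of_ne_bot hN
    obtain ⟨i, hi⟩ := Function.ne_iff.mp hv0
    have h1 : Pi.single i 1 ∈ N.toSubmodule := by
      have h2 : ((#{g : G | M.act g i = i} : ℂ) * v i) • (Pi.single i 1 : ι → ℂ) ∈
          N.toSubmodule := by
        rw [← hM.sum_stabilizer]
        exact N.toSubmodule.sum_mem fun g _ =>
          N.toSubmodule.smul_mem _ (N.apply_mem_toSubmodule g hv)
      refine (N.toSubmodule.smul_mem_iff (mul_ne_zero ?_ hi)).mp h2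
      exact Nat.cast_ne_zero.mpr (card_ne_zero_of_mem (a := 1) (by simp))
    rw [eq_top_iff, ← (Pi.basisFun ℂ ι).span_eq, Submodule.span_le]
    rintro _ ⟨j, rfl⟩
    obtain ⟨g, rfl⟩ := htrans i j
    have h3 := N.apply_mem_toSubmodule g h1
    rw [rep_single, N.toSubmodule.smul_mem_iff (M.coeff_ne_zero g i)] at h3
    simpa using h3
  have : Nontrivial (Subrepresentation M.rep) :=
    ⟨⊥, ⊤, fun h => bot_ne_top (α := Submodule ℂ (ι → ℂ))
      (congrArg Subrepresentation.toSubmodule h)⟩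
  exact ⟨fun N => (hbot N).imp (fun h => Subrepresentation.toSubmodule_injective h)
    fun h => Subrepresentation.toSubmodule_injective h⟩

lemma Separated.char_mem_Irr {ι : Type} [Fintype ι] {M : Monomial G ι} [Nonempty ι]
    (hM : M.Separated) (htrans : ∀ i j, ∃ g, M.act g i = j) : M.char ∈ Irr G :=
  ⟨ι → ℂ, inferInstance, inferInstance, inferInstance, M.rep, hM.isIrreducible htrans,
    M.character_rep⟩

end Irreducible

/-! ### Constituents of a separated monomial representation -/

section Constituents

/-- The restriction of monomial data to an invariant set of basis vectors, given as a fiber of an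
invariant function. -/
def fiber (M : Monomial G ι) (f : ι → κ) (hf : ∀ g i, f (M.act g i) = f i) (k : κ) :
    Monomial G {i // f i = k} where
  act g i := ⟨M.act g i, (hf g i).trans i.2⟩
  coeff g i := M.coeff g i
  act_one i := Subtype.ext (M.act_one i)
  act_mul g h i := Subtype.ext (M.act_mul g h i)
  coeff_mul g h i := M.coeff_mul g h i
  norm_coeff g i := M.norm_coeff g i

lemma Separated.fiber {M : Monomial G ι} (hM : M.Separated) (f : ι → κ)
    (hf : ∀ g i, f (M.act g i) = f i) (k : κ) : (M.fiber f hf k).Separated := by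
  intro i j hij
  obtain ⟨h, h1, h2, h3⟩ := hM i j (fun e => hij (Subtype.ext e))
  exact ⟨h, Subtype.ext h1, Subtype.ext h2, h3⟩

open scoped Classical in
lemma char_eq_sum_fiber [Fintype ι] [Fintype κ] (M : Monomial G ι) (f : ι → κ)
    (hf : ∀ g i, f (M.act g i) = f i) (g : G) :
    M.char g = ∑ k, (M.fiber f hf k).char g := by
  simp only [char, Monomial.fiber, Subtype.ext_iff]
  rw [← Finset.sum_fiberwise _ f]
  refine sum_congr rfl fun k _ => ?_
  exact (Finset.sum_subtype (p := fun i => f i = k) _ (by simp) _)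

/-- First orthogonality relation against a monomial character, for which complex conjugation is
inversion of the argument. -/
lemma charInner_eq_ite [Fintype G] {ι : Type} [Fintype ι] (M : Monomial G ι)
    (hM : M.char ∈ Irr G) {ψ : G → ℂ} (hψ : ψ ∈ Irr G) [Decidable (ψ = M.char)] :
    charInner ψ M.char = if ψ = M.char then 1 else 0 := by
  classical
  obtain ⟨V, _, _, _, ρ, hρ, rfl⟩ := hψ
  obtain ⟨W, _, _, _, σ, hσ, hσM⟩ := hM
  have : Invertible (Nat.card G : ℂ) := invertibleOfNonzero (by simp)
  have h1 := Representation.char_orthonormal ρ σ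
  have h2 : charInner ρ.character M.char =
      (Nat.card G : ℂ)⁻¹ * ∑ g : G, ρ.character g * σ.character g⁻¹ := by
    simp only [charInner, CharTheory.conj, conj_char, hσM, Nat.card_eq_fintype_card]
  rw [h2]
  split_ifs with h
  · have h3 := Representation.char_orthonormal ρ ρ
    rw [if_pos ⟨Representation.Equiv.refl ρ⟩] at h3
    rw [hσM, ← h, h3]
  · rw [h1, if_neg]
    rintro ⟨e⟩
    exact h (by rw [← hσM, Representation.char_iso e])

open scoped Classical in
/-- The sum over `G` of the product of the two coefficients is multiplied by a scalar different
from `1` under translation by a separating element. -/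
lemma Separated.sum_coeff_mul_conj_coeff [Fintype G] {M : Monomial G ι} (hM : M.Separated)
    {i j : ι} (hij : i ≠ j) :
    ∑ g : G, (if M.act g i = i then M.coeff g i else 0) *
      starRingEnd ℂ (if M.act g j = j then M.coeff g j else 0) = 0 := by
  obtain ⟨h, hi, hj, hne⟩ := hM i j hij
  set S := ∑ g : G, (if M.act g i = i then M.coeff g i else 0) *
      starRingEnd ℂ (if M.act g j = j then M.coeff g j else 0) with hS
  have key : S = M.coeff h i * starRingEnd ℂ (M.coeff h j) * S := by
    conv_lhs => rw [hS, ← Equiv.sum_comp (Equiv.mulLeft h)]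
    rw [hS, mul_sum]
    refine sum_congr rfl fun g _ => ?_
    have h1 : ∀ k, M.act h k = k → (M.act (h * g) k = k ↔ M.act g k = k) := by
      intro k hk
      rw [M.act_mul]
      constructor
      · intro h2; exact M.act_injective h (h2.trans hk.symm)
      · intro h2; rw [h2, hk]
    simp only [Equiv.coe_mulLeft, h1 i hi, h1 j hj]
    split_ifs with h3 h4
    · rw [M.coeff_mul, M.coeff_mul, h3, h4, map_mul]; ring
    all_goals simp
  have hc : M.coeff h i * starRingEnd ℂ (M.coeff h j) ≠ 1 := by
    rw [conj_coeff]
    intro h4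
    exact hne ((mul_inv_eq_one₀ (M.coeff_ne_zero h j)).mp h4)
  by_contra hS0
  exact hc ((mul_eq_right₀ hS0).mp key.symm)

lemma Separated.charInner_fiber [Fintype G] [Fintype ι] {M : Monomial G ι} (hM : M.Separated)
    (f : ι → κ) (hf : ∀ g i, f (M.act g i) = f i) {k l : κ} [Fintype {i // f i = k}]
    [Fintype {i // f i = l}] (hkl : k ≠ l) :
    charInner (M.fiber f hf k).char (M.fiber f hf l).char = 0 := by
  classical
  rw [charInner, mul_eq_zero]
  right
  simp only [CharTheory.conj, char, Monomial.fiber, Subtype.ext_iff, map_sum, sum_mul_sum]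
  rw [sum_comm]
  refine sum_eq_zero fun i _ => ?_
  rw [sum_comm]
  refine sum_eq_zero fun j _ => ?_
  exact hM.sum_coeff_mul_conj_coeff fun h => hkl (by rw [← i.2, ← j.2, h])

open scoped ComplexOrder in
/-- The irreducible constituents of a separated monomial representation are counted by the orbits
of lines; here the orbits are the fibers of `f`. -/
lemma Separated.ncard_constituents [Fintype G] {ι : Type} [Fintype ι] [Fintype κ]
    {M : Monomial G ι} (hM : M.Separated) (f : ι → κ) (hsurj : Function.Surjective f)
    (hf : ∀ i j, f i = f j ↔ ∃ g, M.act g i = j) :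
    (constituents M.char).ncard = Fintype.card κ := by
  classical
  have hinv : ∀ g i, f (M.act g i) = f i := fun g i => ((hf _ _).mpr ⟨g, rfl⟩).symm
  set θ : κ → G → ℂ := fun k => (M.fiber f hinv k).char with hθ
  have hirr : ∀ k, θ k ∈ Irr G := by
    intro k
    obtain ⟨i, hi⟩ := hsurj k
    have : Nonempty {i // f i = k} := ⟨⟨i, hi⟩⟩
    refine (hM.fiber f hinv k).char_mem_Irr fun a b => ?_
    obtain ⟨g, hg⟩ := (hf a b).mp (a.2.trans b.2.symm)
    exact ⟨g, Subtype.ext hg⟩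
  have hinj : Function.Injective θ := by
    intro k l hkl
    by_contra hne
    have h1 := hM.charInner_fiber f hinv hne
    rw [charInner_eq_ite _ (hirr l) (hirr k), if_pos hkl] at h1
    exact one_ne_zero h1
  have hsum : ∀ ψ ∈ Irr G, charInner ψ M.char = ∑ k, if ψ = θ k then 1 else 0 := by
    intro ψ hψ
    have h1 : charInner ψ M.char = ∑ k, charInner ψ (θ k) := by
      simp only [charInner, CharTheory.conj, M.char_eq_sum_fiber f hinv, map_sum, mul_sum, hθ]
      rw [sum_comm]
    rw [h1]
    exact sum_congr rfl fun k _ => charInner_eq_ite _ (hirr k) hψ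
  have hset : constituents M.char = Set.range θ := by
    ext ψ
    constructor
    · rintro ⟨h1, h2⟩
      by_contra h3
      rw [hsum ψ h1, sum_eq_zero] at h2
      · exact lt_irrefl _ h2
      · intro k _
        rw [if_neg]
        rintro rfl
        exact h3 ⟨k, rfl⟩
    · rintro ⟨k, rfl⟩
      refine ⟨hirr k, ?_⟩
      rw [hsum _ (hirr k)]
      simp [hinj.eq_iff]
  rw [hset, ← Set.image_univ, Set.ncard_image_of_injective _ hinj, Set.ncard_univ,
    Nat.card_eq_fintype_card]

end Constituents

/-! ### Sums and products of monomial representations -/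

section Constructions

/-- The direct sum of two monomial representations. -/
def sum (M : Monomial G ι) (N : Monomial G κ) : Monomial G (ι ⊕ κ) where
  act g := Sum.map (M.act g) (N.act g)
  coeff g := Sum.elim (M.coeff g) (N.coeff g)
  act_one := by rintro (i | i) <;> simp
  act_mul := by rintro g h (i | i) <;> simp [M.act_mul, N.act_mul]
  coeff_mul := by rintro g h (i | i) <;> simp [M.coeff_mul, N.coeff_mul]
  norm_coeff := by rintro g (i | i) <;> simp

lemma char_sum [Fintype ι] [Fintype κ] (M : Monomial G ι) (N : Monomial G κ) (g : G) :
    (M.sum N).char g = M.char g + N.char g := by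
  simp only [char, sum, Fintype.sum_sum_type, Sum.map_inl, Sum.map_inr, Sum.elim_inl, Sum.elim_inr]
  congr 1 <;> refine sum_congr rfl fun i _ => ?_
  · by_cases h : M.act g i = i <;> simp [h]
  · by_cases h : N.act g i = i <;> simp [h]

/-- The span of the vectors `e i ⊗ conj (e j)` with `i ≠ j` in the tensor product of a monomial
representation with its complex conjugate. -/
def offDiag (M : Monomial G ι) : Monomial G {x : ι × ι // x.1 ≠ x.2} where
  act g x := ⟨(M.act g x.1.1, M.act g x.1.2), fun h => x.2 (M.act_injective g h)⟩
  coeff g x := M.coeff g x.1.1 * starRingEnd ℂ (M.coeff g x.1.2)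
  act_one x := by simp
  act_mul g h x := by simp [M.act_mul]
  coeff_mul g h x := by simp only [M.coeff_mul, map_mul]; ring
  norm_coeff g x := by simp

open scoped Classical in
/-- In the product of a monomial character with its conjugate, the diagonal vectors
`e i ⊗ conj (e i)` contribute the permutation character of the action on lines. -/
lemma char_mul_conj_char [Fintype ι] (M : Monomial G ι) (g : G) :
    M.char g * starRingEnd ℂ (M.char g) =
      M.offDiag.char g + ∑ i, if M.act g i = i then 1 else 0 := by
  have h1 : M.char g * starRingEnd ℂ (M.char g) = ∑ x : ι × ι,
      if M.act g x.1 = x.1 ∧ M.act g x.2 = x.2 then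
        M.coeff g x.1 * starRingEnd ℂ (M.coeff g x.2) else 0 := by
    rw [char, map_sum, sum_mul_sum, ← Fintype.sum_prod_type']
    refine sum_congr rfl fun x _ => ?_
    by_cases h : M.act g x.1 = x.1 <;> by_cases h' : M.act g x.2 = x.2 <;> simp [h, h']
  rw [h1, ← sum_filter_add_sum_filter_not univ (fun x : ι × ι => x.1 ≠ x.2)]
  congr 1
  · simp only [char, offDiag, Subtype.ext_iff, Prod.ext_iff]
    exact (Finset.sum_subtype (p := fun x : ι × ι => x.1 ≠ x.2) _ (by simp) _)
  · simp only [not_not]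
    rw [show ({x : ι × ι | x.1 = x.2} : Finset (ι × ι)) = univ.diag from by ext; simp,
      Finset.sum_diag]
    refine sum_congr rfl fun i _ => ?_
    simp only [and_self]
    split_ifs
    · rw [mul_comm, conj_coeff_mul_coeff]
    · rfl

end Constructions

end Monomial

/-! ### The group of affine substitutions with translations of functions -/

/-- The semidirect product of the group of functions `R → A` and the group of affine maps
`x ↦ unit * x + shift` of `R` whose linear part lies in `U`. -/
@[ext]
structure AffineWreath (A : Type*) {R : Type*} [CommRing R] (U : Subgroup Rˣ) where
  /-- The component in the normal subgroup of functions. -/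
  base : R → A
  /-- The translation part of the affine map. -/
  shift : R
  /-- The linear part of the affine map. -/
  unit : U

namespace AffineWreath

variable {A R : Type*} [AddCommGroup A] [CommRing R] {U : Subgroup Rˣ}

/-- The affine map underlying an element. -/
def point (g : AffineWreath A U) (x : R) : R := ((g.unit : Rˣ) : R) * x + g.shift

/-- The convention for the base component is that `base x` is read off at the source `x` of the
affine map, so that no inverse enters the multiplication. -/
instance : Mul (AffineWreath A U) where
  mul g h := ⟨fun x => g.base (h.point x) + h.base x,
    ((g.unit : Rˣ) : R) * h.shift + g.shift, g.unit * h.unit⟩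

instance : One (AffineWreath A U) := ⟨⟨0, 0, 1⟩⟩

instance : Inv (AffineWreath A U) where
  inv g := ⟨fun x => -g.base (((g.unit⁻¹ : U) : Rˣ) * (x - g.shift)),
    -(((g.unit⁻¹ : U) : Rˣ) * g.shift), g.unit⁻¹⟩

lemma mul_base (g h : AffineWreath A U) (x : R) :
    (g * h).base x = g.base (h.point x) + h.base x := rfl
lemma mul_shift (g h : AffineWreath A U) :
    (g * h).shift = ((g.unit : Rˣ) : R) * h.shift + g.shift := rfl
@[simp] lemma mul_unit (g h : AffineWreath A U) : (g * h).unit = g.unit * h.unit := rfl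
@[simp] lemma one_base : (1 : AffineWreath A U).base = 0 := rfl
@[simp] lemma one_shift : (1 : AffineWreath A U).shift = 0 := rfl
@[simp] lemma one_unit : (1 : AffineWreath A U).unit = 1 := rfl

@[simp] lemma one_point (x : R) : (1 : AffineWreath A U).point x = x := by simp [point]

lemma mul_point (g h : AffineWreath A U) (x : R) : (g * h).point x = g.point (h.point x) := by
  simp only [point, mul_unit, mul_shift, Subgroup.coe_mul, Units.val_mul]
  ring

instance : Group (AffineWreath A U) :=
  Group.ofLeftAxioms
    (fun a b c => by
      ext1
      · ext x; simp [mul_base, mul_point, add_assoc]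
      · simp only [mul_unit, mul_shift, Subgroup.coe_mul, Units.val_mul]; ring
      · exact mul_assoc _ _ _)
    (fun a => by
      ext1
      · ext x; simp [mul_base]
      · simp [mul_shift]
      · exact one_mul _)
    (fun a => by
      ext1
      · ext x
        change -a.base _ + a.base x = 0
        simp [point]
      · change ((a.unit⁻¹ : U) : Rˣ) * a.shift + -(((a.unit⁻¹ : U) : Rˣ) * a.shift) = 0
        exact add_neg_cancel _
      · exact inv_mul_cancel _)

/-- The underlying set is a product of three factors. -/
def equivProd : AffineWreath A U ≃ (R → A) × R × U where
  toFun g := (g.base, g.shift, g.unit)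
  invFun g := ⟨g.1, g.2.1, g.2.2⟩
  left_inv _ := rfl
  right_inv _ := rfl

instance [Finite A] [Finite R] : Finite (AffineWreath A U) := Finite.of_equiv _ equivProd.symm

lemma isPGroup {p : ℕ} [Fact p.Prime] {a r : ℕ} [Finite A] [Finite R] (hA : Nat.card A = p ^ a)
    (hR : Nat.card R = p ^ r) (hU : IsPGroup p U) : IsPGroup p (AffineWreath A U) := by
  obtain ⟨u, hu⟩ := hU.exists_card_eq
  refine IsPGroup.of_card (n := a * p ^ r + (r + u)) ?_
  rw [Nat.card_congr equivProd, Nat.card_prod, Nat.card_prod, Nat.card_fun, hA, hR, hu, pow_add,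
    pow_add, pow_mul]

/-! ### The monomial representation on functions and its Fourier dual -/

section Monomial

/-- The permutation representation of the affine group on the functions on `R`, in the Fourier
basis `∑ x, ε (s * x) • e x`. Affine maps permute this basis up to scalars. -/
def fourierRep [Finite R] (A : Type*) [AddCommGroup A] (U : Subgroup Rˣ) (ε : AddChar R ℂ) :
    Monomial (AffineWreath A U) R where
  act g s := ((g.unit⁻¹ : U) : Rˣ) * s
  coeff g s := ε (-(((g.unit⁻¹ : U) : Rˣ) * s * g.shift))
  act_one s := by simp
  act_mul g h s := by simp [mul_assoc, mul_left_comm]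
  coeff_mul g h s := by
    rw [← AddChar.map_add_eq_mul]
    congr 1
    have h1 : (((g.unit⁻¹ : U) : Rˣ) : R) * ((g.unit : Rˣ) : R) = 1 := by simp
    simp only [mul_unit, mul_shift, mul_inv, Subgroup.coe_mul, Units.val_mul]
    linear_combination (-(((h.unit⁻¹ : U) : Rˣ) : R) * s * h.shift) * h1
  norm_coeff g s := ε.norm_apply _

open scoped Classical in
/-- The permutation character counts fixed points, and Fourier inversion rewrites this count as
the trace in the Fourier basis. -/
lemma card_fixed_eq_char_fourierRep [Fintype R] {ε : AddChar R ℂ} (hε : ε.IsPrimitive)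
    (g : AffineWreath A U) :
    (∑ x, if g.point x = x then 1 else 0 : ℂ) = (fourierRep A U ε).char g := by
  have hN : (Fintype.card R : ℂ) ≠ 0 := Nat.cast_ne_zero.mpr Fintype.card_ne_zero
  refine mul_left_cancel₀ hN ?_
  have h1 : ∀ x : R, (Fintype.card R : ℂ) * (if g.point x = x then 1 else 0) =
      ∑ s, ε (s * (x - g.point x)) := by
    intro x
    rw [AddChar.sum_mulShift _ hε]
    simp only [sub_eq_zero, eq_comm (a := x)]
    split_ifs <;> simp
  have h2 : ∀ s : R, (Fintype.card R : ℂ) *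
      (if (fourierRep A U ε).act g s = s then (fourierRep A U ε).coeff g s else 0) =
      ∑ x, ε (s * (x - g.point x)) := by
    intro s
    have h3 : ∀ x, ε (s * (x - g.point x)) =
        ε (-(s * g.shift)) * ε (x * (s - ((g.unit : Rˣ) : R) * s)) := by
      intro x
      rw [← AddChar.map_add_eq_mul, point]
      congr 1
      ring
    simp only [h3, ← mul_sum]
    rw [AddChar.sum_mulShift _ hε]
    have h4 : (((g.unit⁻¹ : U) : Rˣ) : R) * s = s ↔ s - ((g.unit : Rˣ) : R) * s = 0 := by
      rw [sub_eq_zero, Subgroup.coe_inv, Units.inv_mul_eq_iff_eq_mul]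
    by_cases h5 : (((g.unit⁻¹ : U) : Rˣ) : R) * s = s
    · rw [if_pos (show (fourierRep A U ε).act g s = s from h5), if_pos (h4.mp h5), mul_comm]
      simp only [fourierRep, h5]
    · rw [if_neg (show ¬ (fourierRep A U ε).act g s = s from h5), if_neg (mt h4.mpr h5),
        mul_zero, Nat.cast_zero, mul_zero]
  rw [mul_sum, Monomial.char, mul_sum, sum_congr rfl fun x _ => h1 x, sum_comm]
  exact sum_congr rfl fun s _ => (h2 s).symm

variable [Finite A]

/-- The monomial representation with one basis vector for each point of `R`, on which a function
in the base acts through its value at that point and the character `ψ`. -/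
def pointRep (U : Subgroup Rˣ) (ψ : AddChar A ℂ) : Monomial (AffineWreath A U) R where
  act g x := g.point x
  coeff g x := ψ (g.base x)
  act_one := one_point
  act_mul := mul_point
  coeff_mul g h x := by rw [mul_base, AddChar.map_add_eq_mul]
  norm_coeff g x := ψ.norm_apply _

open scoped Classical in
lemma char_pointRep_mul_conj [Fintype R] (ψ : AddChar A ℂ) {ε : AddChar R ℂ}
    (hε : ε.IsPrimitive) :
    (pointRep U ψ).char * CharTheory.conj (pointRep U ψ).char =
      ((pointRep U ψ).offDiag.sum (fourierRep A U ε)).char := by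
  ext g
  rw [Pi.mul_apply, CharTheory.conj, Monomial.char_mul_conj_char, Monomial.char_sum,
    ← card_fixed_eq_char_fourierRep hε]
  rfl

/-- The element given by a function alone fixes every point. -/
def ofBase (U : Subgroup Rˣ) (f : R → A) : AffineWreath A U := ⟨f, 0, 1⟩

@[simp] lemma pointRep_act_ofBase (ψ : AddChar A ℂ) (f : R → A) (x : R) :
    (pointRep U ψ).act (ofBase U f) x = x := by simp [pointRep, ofBase, point]

@[simp] lemma pointRep_coeff_ofBase (ψ : AddChar A ℂ) (f : R → A) (x : R) :
    (pointRep U ψ).coeff (ofBase U f) x = ψ (f x) := rfl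

lemma pointRep_separated {ψ : AddChar A ℂ} {a : A} (ha : ψ a ≠ 1) :
    (pointRep U ψ).Separated := by
  classical
  intro x y hxy
  refine ⟨ofBase U (Pi.single x a), by simp, by simp, ?_⟩
  simpa [Pi.single_apply, hxy.symm] using ha

lemma pointRep_transitive (ψ : AddChar A ℂ) (x y : R) : ∃ g, (pointRep U ψ).act g x = y :=
  ⟨⟨0, y - x, 1⟩, by simp [pointRep, point]⟩

/-- Functions in the base separate the off-diagonal vectors from each other and from the Fourier
basis, on which they act trivially; translations separate the Fourier basis. A character of order
at most two would not tell `(x, y)` from `(y, x)`. -/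
lemma offDiag_sum_fourierRep_separated [Finite R] {ψ : AddChar A ℂ} {a : A} (ha : ψ a ≠ ψ (-a))
    {ε : AddChar R ℂ} (hε : ε.IsPrimitive) :
    ((pointRep U ψ).offDiag.sum (fourierRep A U ε)).Separated := by
  classical
  have ha1 : ψ a ≠ 1 := by
    intro h
    rw [AddChar.map_neg_eq_inv, h, inv_one] at ha
    exact ha rfl
  have ha2 : ψ (-a) ≠ 1 := by
    rw [AddChar.map_neg_eq_inv]
    simpa using ha1
  have hoff : ∀ (f : R → A) (z : {x : R × R // x.1 ≠ x.2}),
      (pointRep U ψ).offDiag.coeff (ofBase U f) z = ψ (f z.1.1 - f z.1.2) := by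
    intro f z
    rw [AddChar.map_sub_eq_div, div_eq_mul_inv]
    simp only [Monomial.offDiag, Monomial.conj_coeff, pointRep_coeff_ofBase]
  have hoffact : ∀ (f : R → A) (z : {x : R × R // x.1 ≠ x.2}),
      (pointRep U ψ).offDiag.act (ofBase U f) z = z := by
    intro f z
    simp [Monomial.offDiag]
  have hfact : ∀ (f : R → A) (s : R), (fourierRep A U ε).act (ofBase U f) s = s := by
    intro f s
    simp [fourierRep, ofBase]
  have hf : ∀ (f : R → A) (s : R), (fourierRep A U ε).coeff (ofBase U f) s = 1 := by
    intro f s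
    simp [fourierRep, ofBase]
  rintro (⟨⟨x, y⟩, hxy⟩ | s) (⟨⟨x', y'⟩, hxy'⟩ | s') hne
  · by_cases hx : x = x'
    · subst hx
      have hy : y' ≠ y := by rintro rfl; exact hne rfl
      refine ⟨ofBase U (Pi.single y a), ?_, ?_, ?_⟩
      · simp [Monomial.sum, hoffact]
      · simp [Monomial.sum, hoffact]
      · simpa [Monomial.sum, hoff, Pi.single_apply, hy, (show x ≠ y from hxy)] using ha2
    · refine ⟨ofBase U (Pi.single x a), ?_, ?_, ?_⟩
      · simp [Monomial.sum, hoffact]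
      · simp [Monomial.sum, hoffact]
      · have hy : y ≠ x := Ne.symm hxy
        by_cases hy' : y' = x
        · simpa [Monomial.sum, hoff, Pi.single_apply, hy, hy', Ne.symm hx] using ha
        · simpa [Monomial.sum, hoff, Pi.single_apply, hy, hy', Ne.symm hx] using ha1
  · refine ⟨ofBase U (Pi.single x a), ?_, ?_, ?_⟩
    · simp [Monomial.sum, hoffact]
    · simp [Monomial.sum, hfact]
    · have hy : y ≠ x := Ne.symm hxy
      simpa [Monomial.sum, hoff, hf, Pi.single_apply, hy] using ha1
  · refine ⟨ofBase U (Pi.single x' a), ?_, ?_, ?_⟩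
    · simp [Monomial.sum, hfact]
    · simp [Monomial.sum, hoffact]
    · have hy : y' ≠ x' := Ne.symm hxy'
      simpa [Monomial.sum, hoff, hf, Pi.single_apply, hy] using ha1.symm
  · have h1 : ε.mulShift s ≠ ε.mulShift s' := fun h =>
      hne (congrArg Sum.inr (AddChar.to_mulShift_inj_of_isPrimitive hε h))
    obtain ⟨b, hb⟩ := DFunLike.ne_iff.mp h1
    refine ⟨⟨0, -b, 1⟩, ?_, ?_, ?_⟩
    · simp [Monomial.sum, fourierRep]
    · simp [Monomial.sum, fourierRep]
    · simpa [Monomial.sum, fourierRep, AddChar.mulShift_apply] using hb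

/-- The constituents of `χ * conj χ` come in two families. The off-diagonal vectors contribute one
for each `U`-orbit of nonzero differences, the diagonal ones, in the Fourier basis, contribute one
for each `U`-orbit of frequencies. -/
lemma eta_pointRep {R : Type} [CommRing R] {U : Subgroup Rˣ}
    [Fintype (AffineWreath A U)] [Fintype R] {ψ : AddChar A ℂ} {a : A}
    (ha : ψ a ≠ ψ (-a)) {ε : AddChar R ℂ} (hε : ε.IsPrimitive) :
    eta (pointRep U ψ).char (CharTheory.conj (pointRep U ψ).char) + 1 =
      2 * Nat.card (MulAction.orbitRel.Quotient U R) := by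
  classical
  set Q := MulAction.orbitRel.Quotient U R
  have := Fintype.ofFinite Q
  let q : R → Q := Quotient.mk _
  have hq : ∀ x y : R, q x = q y ↔ ∃ u : U, ((u : Rˣ) : R) * x = y := by
    intro x y
    rw [eq_comm]
    exact Quotient.eq.trans (MulAction.orbitRel_apply.trans Iff.rfl)
  have hq0 : ∀ x : R, q x = q 0 ↔ x = 0 := by
    intro x
    rw [eq_comm, hq]
    simp [eq_comm]
  let f : {x : R × R // x.1 ≠ x.2} ⊕ R → {k : Q // k ≠ q 0} ⊕ Q :=
    Sum.map (fun z => ⟨q (z.1.1 - z.1.2), fun h => z.2 (sub_eq_zero.mp ((hq0 _).mp h))⟩) q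
  have hsurj : Function.Surjective f := by
    refine Function.Surjective.sumMap ?_ Quotient.mk_surjective
    rintro ⟨k, hk⟩
    obtain ⟨d, rfl⟩ := Quotient.mk_surjective k
    exact ⟨⟨(d, 0), fun h => hk (congrArg q h)⟩, Subtype.ext (congrArg q (sub_zero d))⟩
  have hf : ∀ i j, f i = f j ↔
      ∃ g, ((pointRep U ψ).offDiag.sum (fourierRep A U ε)).act g i = j := by
    rintro (⟨⟨x, y⟩, hxy⟩ | s) (⟨⟨x', y'⟩, hxy'⟩ | s')
    · simp only [f, Sum.map_inl, Sum.inl.injEq, Subtype.mk.injEq, hq, Monomial.sum,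
        Monomial.offDiag, Prod.mk.injEq, pointRep]
      constructor
      · rintro ⟨u, hu⟩
        -- A translation moves the first point to its target, and the difference does the rest.
        exact ⟨⟨0, x' - (u : Rˣ) * x, u⟩, by simp [point], by
          simp only [point]; linear_combination -hu⟩
      · rintro ⟨g, rfl, rfl⟩
        exact ⟨g.unit, by simp only [point]; ring⟩
    · simp [f, Monomial.sum]
    · simp [f, Monomial.sum]
    · simp only [f, Sum.map_inr, Sum.inr.injEq, hq, Monomial.sum, fourierRep]
      constructor
      · rintro ⟨u, hu⟩
        exact ⟨⟨0, 0, u⁻¹⟩, by simpa using hu⟩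
      · rintro ⟨g, hg⟩
        exact ⟨g.unit⁻¹, hg⟩
  rw [eta, char_pointRep_mul_conj ψ hε,
    (offDiag_sum_fourierRep_separated ha hε).ncard_constituents f hsurj hf, Fintype.card_sum,
    Fintype.card_subtype_compl, Fintype.card_subtype_eq, Nat.card_eq_fintype_card]
  have : 0 < Fintype.card Q := Fintype.card_pos_iff.mpr ⟨q 0⟩
  omega

end Monomial

end AffineWreath

/-! ### Units congruent to one modulo `p` -/

/-- The group of units of `R` congruent to `1` modulo `p`. -/
def principalUnits (p : ℕ) (R : Type*) [CommRing R] : Subgroup Rˣ where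
  carrier := {u | (p : R) ∣ u - 1}
  one_mem' := by simp
  mul_mem' {u v} hu hv := by
    change (p : R) ∣ _
    have : ((u * v : Rˣ) : R) - 1 = (u - 1) * v + (v - 1) := by push_cast; ring
    rw [this]
    exact dvd_add (Dvd.dvd.mul_right hu _) hv
  inv_mem' {u} hu := by
    change (p : R) ∣ _
    have : ((u⁻¹ : Rˣ) : R) - 1 = (u - 1) * -((u⁻¹ : Rˣ) : R) := by
      linear_combination u.mul_inv
    rw [this]
    exact Dvd.dvd.mul_right hu _

lemma mem_principalUnits {p : ℕ} {R : Type*} [CommRing R] {u : Rˣ} :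
    u ∈ principalUnits p R ↔ (p : R) ∣ u - 1 := Iff.rfl

namespace ZMod

variable {p n : ℕ}

lemma isPGroup_principalUnits (p n : ℕ) : IsPGroup p (principalUnits p (ZMod (p ^ n))) := by
  rintro ⟨u, hu⟩
  refine ⟨n, Subtype.ext (Units.ext ?_)⟩
  have h1 := dvd_sub_pow_of_dvd_sub (mem_principalUnits.mp hu) n
  have h2 : ((p : ZMod (p ^ n)) ^ (n + 1)) = 0 := by
    rw [pow_succ, ← Nat.cast_pow, ZMod.natCast_self, zero_mul]
  rw [h2, zero_dvd_iff, one_pow, sub_eq_zero] at h1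
  simpa using h1

/-- A residue modulo `p ^ n` of the form `p ^ i * a` with `p ∤ a` and `i < n` has valuation exactly
`i`. -/
lemma natCast_dvd_of_pow_succ_dvd (hp : p.Prime) {i : ℕ} (hi : i < n) {a : ℤ}
    (h : (p : ZMod (p ^ n)) ^ (i + 1) ∣ p ^ i * a) : (p : ℤ) ∣ a := by
  obtain ⟨c, hc⟩ := h
  obtain ⟨c, rfl⟩ := ZMod.intCast_surjective c
  have h1 : (((p : ℤ) ^ i * a - p ^ (i + 1) * c : ℤ) : ZMod (p ^ n)) = 0 := by
    push_cast
    rw [hc, sub_self]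
  rw [ZMod.intCast_zmod_eq_zero_iff_dvd] at h1
  have h2 : (p : ℤ) ^ (i + 1) ∣ p ^ i * a - p ^ (i + 1) * c :=
    (pow_dvd_pow _ hi).trans (by exact_mod_cast h1)
  have h3 : (p : ℤ) ^ (i + 1) ∣ p ^ i * a := by
    have := dvd_add h2 (dvd_mul_right ((p : ℤ) ^ (i + 1)) c)
    simpa using this
  rw [pow_succ] at h3
  exact (mul_dvd_mul_iff_left (pow_ne_zero _ (by exact_mod_cast hp.ne_zero))).mp h3

/-- A nonzero residue modulo `p ^ n` is determined up to units congruent to `1` modulo `p` by its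
valuation and the leading `p`-adic digit. -/
lemma card_orbits_principalUnits (hp : p.Prime) (n : ℕ) :
    Nat.card (MulAction.orbitRel.Quotient (principalUnits p (ZMod (p ^ n))) (ZMod (p ^ n))) =
      n * (p - 1) + 1 := by
  let R := ZMod (p ^ n)
  let U := principalUnits p R
  let Q := MulAction.orbitRel.Quotient U R
  let rep : Option (Fin n × Fin (p - 1)) → R := fun o =>
    o.elim 0 fun ir => (p : R) ^ (ir.1 : ℕ) * ((ir.2 + 1 : ℕ) : R)
  let F : Option (Fin n × Fin (p - 1)) → Q := fun o => Quotient.mk _ (rep o)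
  have hq : ∀ x y : R, (Quotient.mk _ x : Q) = Quotient.mk _ y ↔
      ∃ u : U, ((u : Rˣ) : R) * y = x := fun x y =>
    Quotient.eq.trans (MulAction.orbitRel_apply.trans Iff.rfl)
  have hdigit : ∀ r : Fin (p - 1), ¬ (p : ℤ) ∣ ((r + 1 : ℕ) : ℤ) := by
    intro r h
    have := Nat.le_of_dvd (Nat.succ_pos _) (Int.natCast_dvd_natCast.mp h)
    have := r.2
    omega
  -- Multiplication by a unit does not change the valuation.
  have hvaldvd : ∀ {i j : ℕ}, i < n → i < j → ∀ {r : Fin (p - 1)} {c : R} {u : Rˣ},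
      (u : R) * ((p : R) ^ i * ((r + 1 : ℕ) : R)) ≠ p ^ j * c := by
    intro i j hi hij r c u h
    refine hdigit r (natCast_dvd_of_pow_succ_dvd hp hi ?_)
    have h2 : (p : R) ^ i * (((r + 1 : ℕ) : ℤ) : R) = p ^ j * (c * ((u⁻¹ : Rˣ) : R)) := by
      rw [Int.cast_natCast, ← mul_assoc, ← h, mul_right_comm, Units.mul_inv, one_mul]
    refine h2 ▸ ?_
    exact Dvd.dvd.mul_right (pow_dvd_pow _ hij) _
  have hrep0 : ∀ ir, rep (some ir) ≠ 0 := by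
    intro ir h
    refine hvaldvd ir.1.2 (Nat.lt_succ_self _) (r := ir.2) (c := 0) (u := 1) ?_
    rw [mul_zero, Units.val_one, one_mul]
    exact h
  have hinj : Function.Injective F := by
    rintro (_ | ⟨i, r⟩) (_ | ⟨j, s⟩) h
    · rfl
    · obtain ⟨u, hu⟩ := (hq _ _).mp h
      exact absurd ((Units.mul_right_eq_zero _).mp hu) (hrep0 _)
    · obtain ⟨u, hu⟩ := (hq _ _).mp h
      exact absurd (hu.symm.trans (mul_zero _)) (hrep0 _)
    · obtain ⟨u, hu⟩ := (hq _ _).mp h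
      change ((u : Rˣ) : R) * ((p : R) ^ (j : ℕ) * ((s + 1 : ℕ) : R)) =
        (p : R) ^ (i : ℕ) * ((r + 1 : ℕ) : R) at hu
      have hij : i = j := by
        rcases lt_trichotomy (i : ℕ) j with hlt | heq | hlt
        · refine absurd ?_ (hvaldvd (r := r) (c := ((s + 1 : ℕ) : R)) (u := (u : Rˣ)⁻¹) i.2 hlt)
          rw [← hu, Units.inv_mul_cancel_left]
        · exact Fin.ext heq
        · exact absurd hu (hvaldvd j.2 hlt)
      subst hij
      obtain ⟨t, ht⟩ := u.2
      -- As `u` is `1` modulo `p`, it does not change the leading digit.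
      have hdvd : (p : ℤ) ∣ ((r + 1 : ℕ) : ℤ) - ((s + 1 : ℕ) : ℤ) := by
        refine natCast_dvd_of_pow_succ_dvd hp i.2 ⟨t * ((s + 1 : ℕ) : R), ?_⟩
        push_cast at hu ⊢
        linear_combination -hu + (p : R) ^ (i : ℕ) * ((s : R) + 1) * ht
      have hrs : r = s := by
        have h0 := Int.eq_zero_of_abs_lt_dvd hdvd (by
          have := r.2; have := s.2
          rw [abs_lt]; push_cast; omega)
        exact Fin.ext (by push_cast at h0; omega)
      rw [hrs]
  have hsurj : Function.Surjective F := by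
    intro k
    obtain ⟨x, rfl⟩ := Quotient.mk_surjective k
    have : NeZero (p ^ n) := ⟨pow_ne_zero _ hp.ne_zero⟩
    by_cases hx : x = 0
    · exact ⟨none, by rw [hx]; rfl⟩
    · have hv0 : x.val ≠ 0 := (ZMod.val_ne_zero x).mpr hx
      obtain ⟨i, m, hm, him⟩ := Nat.exists_eq_pow_mul_and_not_dvd hv0 p hp.ne_one
      have hxm : x = (p : R) ^ i * (m : R) := by
        rw [← Nat.cast_pow, ← Nat.cast_mul, ← him, ZMod.natCast_zmod_val]
      have hi : i < n := by
        refine (Nat.pow_lt_pow_iff_right hp.one_lt).mp (lt_of_le_of_lt ?_ (ZMod.val_lt x))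
        rw [him]
        exact Nat.le_mul_of_pos_right _ (Nat.pos_of_ne_zero (by rintro rfl; simp at hm))
      have hr0 : m % p ≠ 0 := fun h => hm (Nat.dvd_of_mod_eq_zero h)
      have hrp : m % p < p := Nat.mod_lt _ hp.pos
      have hcop : ∀ a : ℕ, ¬ p ∣ a → a.Coprime (p ^ n) := fun a ha =>
        Nat.Coprime.pow_right _ ((hp.coprime_iff_not_dvd.mpr ha).symm)
      have hr : ¬ p ∣ m % p := fun h =>
        hr0 (Nat.eq_zero_of_dvd_of_lt h hrp)
      let v : Rˣ := ZMod.unitOfCoprime m (hcop m hm)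
      let w : Rˣ := ZMod.unitOfCoprime (m % p) (hcop _ hr)
      have hv : (v : R) = m := rfl
      have hw : (w : R) = (m % p : ℕ) := rfl
      have hmod : (m : R) = p * (m / p : ℕ) + (m % p : ℕ) := by
        rw [← Nat.cast_mul, ← Nat.cast_add, Nat.div_add_mod]
      -- The unit part `m` is replaced by its residue modulo `p`.
      have hmem : w * v⁻¹ ∈ U := by
        refine mem_principalUnits.mpr ⟨-((m / p : ℕ) : R) * ((v⁻¹ : Rˣ) : R), ?_⟩
        have h1 := v.mul_inv
        rw [Units.val_mul, hw]
        rw [hv] at h1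
        linear_combination h1 - ((v⁻¹ : Rˣ) : R) * hmod
      refine ⟨some (⟨i, hi⟩, ⟨m % p - 1, by omega⟩), (hq _ _).mpr ⟨⟨w * v⁻¹, hmem⟩, ?_⟩⟩
      change ((w * v⁻¹ : Rˣ) : R) * x = (p : R) ^ i * ((m % p - 1 + 1 : ℕ) : R)
      rw [Nat.sub_add_cancel (Nat.pos_of_ne_zero hr0), hxm, ← hw, ← hv, Units.val_mul]
      have h1 := v.inv_mul
      linear_combination ((w : R) * p ^ i) * h1
  rw [← Nat.card_congr (Equiv.ofBijective F ⟨hinj, hsurj⟩)]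
  simp

end ZMod

/-! ### Existence of the character for all degrees -/

theorem mainTheorem4 (p : ℕ) (hp : p.Prime) (n : ℕ) :
    ∃ (G : Type) (_ : Group G) (_ : Fintype G) (χ : G → ℂ),
      IsPGroup p G ∧ χ ∈ CharTheory.Irr G ∧ χ ≠ CharTheory.conj χ ∧
        CharTheory.eta χ (CharTheory.conj χ) = 2 * n * (p - 1) + 1 ∧
        χ 1 = (p : ℂ) ^ n := by
  have : Fact p.Prime := ⟨hp⟩
  have : NeZero (p ^ n) := ⟨pow_ne_zero _ hp.ne_zero⟩
  have : NeZero (p ^ 2) := ⟨pow_ne_zero _ hp.ne_zero⟩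
  let R := ZMod (p ^ n)
  let U := principalUnits p R
  let A := ZMod (p ^ 2)
  let ψ : AddChar A ℂ := ZMod.stdAddChar
  -- Modulo `p ^ 2 ≥ 4`, the elements `1` and `-1` are distinct, even for `p = 2`.
  have ha : ψ 1 ≠ ψ (-1) := by
    intro h
    have h1 := ZMod.injective_stdAddChar h
    have h2 : ((2 : ℕ) : A) = 0 := by
      have : (1 : A) + 1 = 0 := by nth_rewrite 1 [h1]; ring
      rw [← this]; norm_num
    rw [ZMod.natCast_eq_zero_iff] at h2
    have := Nat.le_of_dvd two_pos h2
    have := hp.two_le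
    nlinarith
  have ha1 : ψ 1 ≠ 1 := by
    intro h
    rw [AddChar.map_neg_eq_inv, h, inv_one] at ha
    exact ha rfl
  refine ⟨AffineWreath A U, inferInstance, Fintype.ofFinite _, (AffineWreath.pointRep U ψ).char,
    ?_, ?_, ?_, ?_, ?_⟩
  · exact AffineWreath.isPGroup (Nat.card_zmod _) (Nat.card_zmod _)
      (ZMod.isPGroup_principalUnits p n)
  · let _ : Fintype (AffineWreath A U) := Fintype.ofFinite _
    exact (AffineWreath.pointRep_separated ha1).char_mem_Irr (AffineWreath.pointRep_transitive ψ)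
  · intro h
    -- On the constant function `1` the character takes the value `p ^ n * ψ 1`.
    have hval : ∀ c : A, (AffineWreath.pointRep U ψ).char (AffineWreath.ofBase U fun _ => c) =
        (p : ℂ) ^ n * ψ c := by
      intro c
      simp [Monomial.char, R]
    have h1 := congrFun h (AffineWreath.ofBase U fun _ => 1)
    rw [CharTheory.conj, hval, map_mul, map_pow, map_natCast, ← AddChar.map_neg_eq_conj] at h1
    exact ha (mul_left_cancel₀ (pow_ne_zero _ (Nat.cast_ne_zero.mpr hp.ne_zero)) h1)
  · let _ : Fintype (AffineWreath A U) := Fintype.ofFinite _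
    have h1 := AffineWreath.eta_pointRep (U := U) ha (ZMod.isPrimitive_stdAddChar (p ^ n))
    rw [ZMod.card_orbits_principalUnits hp n] at h1
    have h2 : 2 * (n * (p - 1) + 1) = 2 * n * (p - 1) + 1 + 1 := by ring
    exact Nat.succ_injective (h1.trans h2)
  · rw [Monomial.char_one, ZMod.card]
    push_cast
    rfl
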